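/- Let $D$ be a square-free positive integer with $D\equiv 1\pmod 4$ of the form $D=s^2+4$, $s\in\mathbb{Z}$. Let $F=\mathbb{Q}(\sqrt D)$, with ring of integers $\mathbb{Z}_F$ and real embeddings $\sigma_1,\sigma_2$, and let $B=\left(\frac{-1,-1}{F}\right)$ be the quaternion algebra with $F$-basis $1,i,j,k$, $i^2=j^2=-1$, $ij=-ji=k$. Let $\beta_1,\dots,\beta_4\in B$ be $$1,\quad i,\quad \tfrac{\sqrt D+1}{4}+\tfrac{\sqrt D+3}{4}i+\tfrac j2,\quad \tfrac{\sqrt D+3}{4}+\tfrac{\sqrt D+1}{4}i+\tfrac k2\qquad\text{if } D\not\equiv 1\pmod 8,$$ $$1,\quad i,\quad j,\quad \tfrac{1+i+j+k}{2}\qquad\text{if } D\equiv 1\pmod 8$$ (the second case does not actually occur when $D=s^2+4$), and let $\mathcal{O}=\mathbb{Z}_F\beta_1+\mathbb{Z}_F\beta_2+\mathbb{Z}_F\beta_3+\mathbb{Z}_F\beta_4$. Put $\varepsilon=\frac{s+\sqrt D}{2}$ and $\alpha=\frac{\varepsilon}{\sqrt D}$. Then $\mathcal{O}$ is a maximal order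 of $B$ (a finitely generated $\mathbb{Z}_F$-submodule which spans $B$ over $F$ and is a subring, not properly contained in another such), and $\alpha$ is totally positive. Let $\Lambda_{(\mathcal{O},\alpha)}\subset\mathbb{R}^8$ be the image of $\mathcal{O}$ under $$x+yi+zj+tk\ \mapsto\ \left(\sqrt{2\sigma_1(\alpha)}\,\sigma_1(x),\ \sqrt{2\sigma_2(\alpha)}\,\sigma_2(x),\ \dots,\ \sqrt{2\sigma_1(\alpha)}\,\sigma_1(t),\ \sqrt{2\sigma_2(\alpha)}\,\sigma_2(t)\right).$$ Then $\Lambda_{(\mathcal{O},\alpha)}$ is similar to the lattice $E_8$, that is, some linear isometry followed by a homothety maps it onto $$E_8=\left\{x\in\mathbb{Z}^8\cup\left(\mathbb{Z}+\tfrac12\right)^8:\ \textstyle\sum_m x_m\in 2\mathbb{Z}\right\}.$$ Moreover, for every $\mathbb{Z}$-basis $\omega_1,\omega_2$ of $\mathbb{Z}_F$, writing $\beta_s=\beta_{s1}+\beta_{s2}i+\beta_{s3}j+\beta_{s4}k$, the $8\times 8$ matrix with rows indexed by $(s,r)$ and columns indexed by $(l,m)$, for $s,l\in\{1,2,3,4\}$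 and $r,m\in\{1,2\}$, and with entries $$\sqrt{2\sigma_m(\alpha)}\ \sigma_m(\omega_r\beta_{sl}),$$ is a generator matrix of $\Lambda_{(\mathcal{O},\alpha)}$: its rows are linearly independent over $\mathbb{R}$ and generate $\Lambda_{(\mathcal{O},\alpha)}$ as an abelian group. -/

import Mathlib

open scoped NumberField Quaternion

noncomputable section

/-! ### Orders in quaternion algebras

The quaternion algebra `(a, b / F)` is Mathlib's `ℍ[F,a,b]`: the `F`-algebra with basis
`1, i, j, k`, where `i ^ 2 = a`, `j ^ 2 = b`, `i * j = -j * i = k`. -/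

/-- An order of `(a, b / F)`: a finitely generated `𝓞 F`-submodule which contains an `F`-basis of
the algebra and is a subring. -/
structure IsQuaternionOrder {F : Type*} [Field F] {a b : F}
    (O : Submodule (𝓞 F) ℍ[F,a,b]) : Prop where
  fg : O.FG
  span_eq_top : Submodule.span F (O : Set ℍ[F,a,b]) = ⊤
  one_mem : (1 : ℍ[F,a,b]) ∈ O
  mul_mem : ∀ x ∈ O, ∀ y ∈ O, x * y ∈ O

/-- A maximal order: an order that is not properly contained in another order. -/
structure IsMaximalQuaternionOrder {F : Type*} [Field F] {a b : F}
    (O : Submodule (𝓞 F) ℍ[F,a,b]) : Prop where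
  isOrder : IsQuaternionOrder O
  eq_of_le : ∀ O' : Submodule (𝓞 F) ℍ[F,a,b], IsQuaternionOrder O' → O ≤ O' → O = O'

/-- For `D ≡ 1 (mod 4)` and `δ = √D` in `F = ℚ(√D)`, the `𝓞 F`-basis of the standard maximal order
of `(-1, -1 / F)`. It is `1, i, j, (1 + i + j + k) / 2` if `D ≡ 1 (mod 8)`, and otherwise
`1, i, (δ + 1) / 4 + (δ + 3) / 4 * i + j / 2, (δ + 3) / 4 + (δ + 1) / 4 * i + k / 2`. -/
def orderBasis {F : Type*} [Field F] (D : ℤ) (δ : F) : Fin 4 → ℍ[F,-1,-1] :=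
  if D ≡ 1 [ZMOD 8] then
    ![⟨1, 0, 0, 0⟩, ⟨0, 1, 0, 0⟩, ⟨0, 0, 1, 0⟩, ⟨1 / 2, 1 / 2, 1 / 2, 1 / 2⟩]
  else
    ![⟨1, 0, 0, 0⟩, ⟨0, 1, 0, 0⟩,
      ⟨(δ + 1) / 4, (δ + 3) / 4, 1 / 2, 0⟩,
      ⟨(δ + 3) / 4, (δ + 1) / 4, 0, 1 / 2⟩]

/-- The standard maximal order: the `𝓞 F`-span of `orderBasis D δ`. -/
def standardOrder {F : Type*} [Field F] (D : ℤ) (δ : F) : Submodule (𝓞 F) ℍ[F,-1,-1] :=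
  Submodule.span (𝓞 F) (Set.range (orderBasis D δ))

/-! ### Twisted ideal lattices -/

/-- `α` is totally positive (in a totally real field). -/
def IsTotallyPositive {F : Type*} [Field F] (α : F) : Prop :=
  ∀ σ : F →+* ℝ, 0 < σ α

/-- The four coordinates of `x + y i + z j + t k` with respect to `1, i, j, k`. -/
def quaternionCoord {F : Type*} [Field F] {a b : F} (q : ℍ[F,a,b]) : Fin 4 → F :=
  ![q.re, q.imI, q.imJ, q.imK]

/-- The twisted embedding `σ_{B,α}` of `B = (a, b / F)`, for `F` totally real. It sends
`x + y i + z j + t k` to the vector with coordinates `√(2 σ(α)) σ(x)`, `√(2 σ(α)) σ(y)`,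
`√(2 σ(α)) σ(z)`, `√(2 σ(α)) σ(t)`, where `σ` runs through the real embeddings of `F`. The
coordinates are indexed by a position in `Fin 4` and a real embedding. -/
def twistedEmbedding {F : Type*} [Field F] {a b : F} (α : F) :
    ℍ[F,a,b] →+ EuclideanSpace ℝ (Fin 4 × (F →+* ℝ)) where
  toFun q := WithLp.toLp 2 fun p => √(2 * p.2 α) * p.2 (quaternionCoord q p.1)
  map_zero' := by
    ext ⟨l, σ⟩
    fin_cases l <;> simp [quaternionCoord]
  map_add' x y := by
    ext ⟨l, σ⟩
    fin_cases l <;> simp [quaternionCoord, mul_add]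

/-- The lattice `Λ_(I,α)` given by `I` and twisted by `α`: the image of `I` under the twisted
embedding. -/
def twistedLattice {F : Type*} [Field F] {a b : F} (I : Submodule (𝓞 F) ℍ[F,a,b]) (α : F) :
    AddSubgroup (EuclideanSpace ℝ (Fin 4 × (F →+* ℝ))) :=
  I.toAddSubgroup.map (twistedEmbedding α)

/-- The matrix `M_α` attached to a `ℤ`-basis `ω_1, …, ω_n` of `𝓞 F` and a family
`β_1, …, β_4` in `B`. The row `(s, r)` and the column `(l, σ)` meet in
`√(2 σ(α)) σ(ω_r β_{s l})`, where `β_s = β_{s 1} + β_{s 2} i + β_{s 3} j + β_{s 4} k`. -/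
def twistedMatrix {F : Type*} [Field F] {a b : F} {n : ℕ} (ω : Module.Basis (Fin n) ℤ (𝓞 F))
    (β : Fin 4 → ℍ[F,a,b]) (α : F) : Matrix (Fin 4 × Fin n) (Fin 4 × (F →+* ℝ)) ℝ :=
  Matrix.of fun p q => √(2 * q.2 α) * q.2 ((ω p.2 : F) * quaternionCoord (β p.1) q.1)

/-! ### Euclidean lattices -/

/-- `M` is a generator matrix of `Λ`: its rows are linearly independent over `ℝ` and form a
`ℤ`-basis of `Λ`. -/
def IsGeneratorMatrix {m ι : Type*} (M : Matrix m ι ℝ) (Λ : AddSubgroup (EuclideanSpace ℝ ι)) :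
    Prop :=
  LinearIndependent ℝ (fun r : m => (WithLp.toLp 2 (M r) : EuclideanSpace ℝ ι)) ∧
    AddSubgroup.closure (Set.range fun r : m => (WithLp.toLp 2 (M r) : EuclideanSpace ℝ ι)) = Λ

/-- Two lattices in Euclidean spaces are similar if a linear isometry of the ambient spaces,
followed by a homothety, maps one onto the other. -/
def IsSimilarLattice {V W : Type*} [NormedAddCommGroup V] [InnerProductSpace ℝ V]
    [NormedAddCommGroup W] [InnerProductSpace ℝ W] (Λ : AddSubgroup V) (Λ' : AddSubgroup W) :
    Prop :=
  ∃ c : ℝ, 0 < c ∧ ∃ f : V ≃ₗᵢ[ℝ] W, (fun x => c • f x) '' (Λ : Set V) = (Λ' : Set W)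

/-- The lattice `E₈`: the vectors of `ℝ⁸` whose coordinates are all integers or all
half-integers (elements of `ℤ + 1 / 2`), and whose coordinate sum is an even integer. -/
def latticeE8 : AddSubgroup (EuclideanSpace ℝ (Fin 8)) where
  carrier := {x | ((∀ i, ∃ m : ℤ, x i = m) ∨ (∀ i, ∃ m : ℤ, x i = m + 1 / 2)) ∧
    ∃ m : ℤ, ∑ i, x i = 2 * m}
  zero_mem' := ⟨Or.inl fun _ => ⟨0, by simp⟩, 0, by simp⟩
  neg_mem' := by
    rintro x ⟨hx, n, hn⟩
    refine ⟨?_, -n, by simp [Finset.sum_neg_distrib, hn]⟩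
    rcases hx with hx | hx
    · left
      intro i
      obtain ⟨m, hm⟩ := hx i
      exact ⟨-m, by simp [hm]⟩
    · right
      intro i
      obtain ⟨m, hm⟩ := hx i
      exact ⟨-m - 1, by simp only [PiLp.neg_apply, hm]; push_cast; ring⟩
  add_mem' := by
    rintro x y ⟨hx, n, hn⟩ ⟨hy, k, hk⟩
    refine ⟨?_, n + k, by
      simp only [PiLp.add_apply, Finset.sum_add_distrib, hn, hk]; push_cast; ring⟩
    rcases hx with hx | hx <;> rcases hy with hy | hy
    · left
      intro i
      obtain ⟨m, hm⟩ := hx i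
      obtain ⟨l, hl⟩ := hy i
      exact ⟨m + l, by simp only [PiLp.add_apply, hm, hl]; push_cast; ring⟩
    · right
      intro i
      obtain ⟨m, hm⟩ := hx i
      obtain ⟨l, hl⟩ := hy i
      exact ⟨m + l, by simp only [PiLp.add_apply, hm, hl]; push_cast; ring⟩
    · right
      intro i
      obtain ⟨m, hm⟩ := hx i
      obtain ⟨l, hl⟩ := hy i
      exact ⟨m + l, by simp only [PiLp.add_apply, hm, hl]; push_cast; ring⟩
    · left
      intro i
      obtain ⟨m, hm⟩ := hx i
      obtain ⟨l, hl⟩ := hy i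
      exact ⟨m + l + 1, by simp only [PiLp.add_apply, hm, hl]; push_cast; ring⟩

end

/-!
Since `D = s ^ 2 + 4` is odd, `s` is odd and `D ≡ 5 (mod 8)`, so the standard order `O` is the one
with basis `1, i, p = (w + (w + 1) i + j) / 2, q = ((w + 1) + w i + k) / 2`, where
`w = (1 + √D) / 2`.

Maximality. If `x` lies in an order containing `O`, then the reduced traces of `x`, `x i`, `x p`
and `x q` are algebraic integers. The order `O` is self-dual for the reduced trace form, that is,
these four conditions already imply `x ∈ O` (`isMaximalQuaternionOrder_standardOrder`).

Similarity to `E₈`. Let `η = (√D - s) / 2 = ε⁻¹`. The ring of integers of `F` is `ℤ + ℤ η`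
(`exists_int_add_int_mul_of_isIntegral`), and the choice `α = ε / √D` makes `1, η` an orthonormal
basis for the trace form `Tr (α x y)` (`twisted_trace_form`). Hence the twisted embedding turns the
quaternions with integral coordinates into `√2 ℤ⁸`. The order `O` lies between these quaternions and
their halves, and the quotient is a binary code of length `8`, defined by linear conditions modulo
`2` on the integral coordinates (`mem_standardOrder_iff_exists_int`). Up to a permutation of the
coordinates, which depends on `s` modulo `4`, it is the extended Hamming code, and construction A
applied to that code gives `E₈`: an explicit isometry is the orthogonal sum of four copies of
`(x, y) ↦ (x + y, x - y) / √2`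
(`isSimilarLattice_latticeE8_of_isHammingVector`). No classification of even unimodular lattices is
needed.

Generator matrix. The eight rows generate the lattice because the `ω_r β_s` generate `O` as a group
(`closure_twistedMatrix`). The lattice is similar to `E₈`, so it spans `ℝ⁸`, and eight vectors
spanning `ℝ⁸` are linearly independent.
-/

/-! ### The quadratic field `ℚ(√D)` -/

/-- A square-free integer other than `1` is not the square of a rational number. -/
theorem Squarefree.ratCast_sq_ne {D : ℤ} (hD : Squarefree D) (hD1 : D ≠ 1) (r : ℚ) :
    r ^ 2 ≠ D := by
  intro h
  have hr : IsIntegral ℤ r := .of_pow two_pos (h ▸ isIntegral_algebraMap (A := ℚ) (x := D))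
  obtain ⟨m, rfl⟩ := IsIntegrallyClosed.isIntegral_iff.mp hr
  have h' : m * m = D := by
    rw [eq_intCast] at h
    rw [← sq]; exact_mod_cast h
  rcases Int.isUnit_iff.mp (hD m ⟨1, by rw [h', mul_one]⟩) with rfl | rfl <;> simp_all

/-- If `D r ^ 2` is an integer for a square-free integer `D`, then the rational number `r` is an
integer. -/
theorem Squarefree.exists_int_eq_of_mul_sq {D : ℤ} (hD : Squarefree D) {r : ℚ} {N : ℤ}
    (h : D * r ^ 2 = N) : ∃ k : ℤ, r = k := by
  have hD0 : D ≠ 0 := hD.ne_zero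
  have hDr : IsIntegral ℤ ((D : ℚ) * r) := by
    refine .of_pow two_pos ?_
    have : ((D : ℚ) * r) ^ 2 = algebraMap ℤ ℚ (D * N) := by
      push_cast [eq_intCast]; rw [← h]; ring
    rw [this]
    exact isIntegral_algebraMap
  obtain ⟨k, hk⟩ := IsIntegrallyClosed.isIntegral_iff.mp hDr
  rw [eq_intCast] at hk
  have h2 : k ^ 2 = D * N := by
    have : (k : ℚ) ^ 2 = D * N := by rw [hk, ← h]; ring
    exact_mod_cast this
  obtain ⟨l, rfl⟩ := (hD.dvd_pow_iff_dvd two_ne_zero).mp ⟨N, h2⟩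
  refine ⟨l, ?_⟩
  have : (D : ℚ) ≠ 0 := by exact_mod_cast hD0
  push_cast at hk
  exact (mul_left_cancel₀ this hk).symm

section QuadraticField

variable {F : Type*} [Field F] [NumberField F] {D : ℤ} {δ : F}

open Polynomial in
theorem minpoly_sqrt_eq (hDsq : Squarefree D) (hD1 : D ≠ 1) (hδ : δ ^ 2 = (D : F)) :
    minpoly ℚ δ = X ^ 2 - C (D : ℚ) := by
  refine (minpoly.eq_of_irreducible_of_monic ?_ ?_ (monic_X_pow_sub_C _ two_ne_zero)).symm
  · exact X_pow_sub_C_irreducible_of_prime Nat.prime_two (hDsq.ratCast_sq_ne hD1)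
  · simp [hδ]

/-- A square root of `D` in a `ℚ`-algebra `A` gives an embedding of `ℚ(√D)` into `A`. -/
theorem exists_algHom_sqrt_eq {A : Type*} [Ring A] [Algebra ℚ A] (hDsq : Squarefree D)
    (hD1 : D ≠ 1) (hδ : δ ^ 2 = (D : F)) (hF : IntermediateField.adjoin ℚ {δ} = ⊤) {y : A}
    (hy : y ^ 2 = (D : A)) : ∃ f : F →ₐ[ℚ] A, f δ = y := by
  have hint : IsIntegral ℚ δ := Algebra.IsIntegral.isIntegral δ
  have htop : Algebra.adjoin ℚ {δ} = ⊤ := by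
    rw [← IntermediateField.adjoin_simple_toSubalgebra_of_isAlgebraic hint.isAlgebraic, hF]; rfl
  let pb := PowerBasis.ofAdjoinEqTop hint htop
  have hgen : pb.gen = δ := PowerBasis.ofAdjoinEqTop_gen hint htop
  have hroot : Polynomial.aeval y (minpoly ℚ pb.gen) = 0 := by
    rw [hgen, minpoly_sqrt_eq hDsq hD1 hδ]; simp [hy]
  exact ⟨pb.lift y hroot, by conv_lhs => rw [← hgen, pb.lift_gen]⟩

theorem exists_rat_add_rat_mul_sqrt (hδ : δ ^ 2 = (D : F))
    (hF : IntermediateField.adjoin ℚ {δ} = ⊤) (x : F) : ∃ a b : ℚ, x = a + b * δ := by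
  have hint : IsIntegral ℚ δ := Algebra.IsIntegral.isIntegral δ
  have htop : Algebra.adjoin ℚ {δ} = ⊤ := by
    rw [← IntermediateField.adjoin_simple_toSubalgebra_of_isAlgebraic hint.isAlgebraic, hF]; rfl
  have hx : x ∈ Algebra.adjoin ℚ {δ} := htop ▸ Algebra.mem_top
  induction hx using Algebra.adjoin_induction with
  | mem y hy => exact ⟨0, 1, by simpa using hy⟩
  | algebraMap r => exact ⟨r, 0, by simp⟩
  | add y z _ _ hy hz =>
    obtain ⟨a, b, rfl⟩ := hy
    obtain ⟨c, d, rfl⟩ := hz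
    exact ⟨a + c, b + d, by push_cast; ring⟩
  | mul y z _ _ hy hz =>
    obtain ⟨a, b, rfl⟩ := hy
    obtain ⟨c, d, rfl⟩ := hz
    exact ⟨a * c + b * d * D, a * d + b * c, by
      push_cast; linear_combination (b * d : F) * hδ⟩

/-- For odd `s` and `D ≡ 1 (mod 4)`, the ring of integers of `ℚ(√D)` is contained in
`ℤ + ℤ (√D - s) / 2`. -/
theorem exists_int_add_int_mul_of_isIntegral (hDsq : Squarefree D) (hD1 : D ≠ 1)
    (hδ : δ ^ 2 = (D : F)) (hF : IntermediateField.adjoin ℚ {δ} = ⊤) {s : ℤ} (hs : Odd s)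
    (hDmod : D ≡ 1 [ZMOD 4]) {x : F} (hx : IsIntegral ℤ x) :
    ∃ m n : ℤ, x = m + n * ((δ - s) / 2) := by
  obtain ⟨a, b, rfl⟩ := exists_rat_add_rat_mul_sqrt hδ hF x
  -- the conjugate of `x` is integral, hence so are the trace `2 a` and the norm `a² - D b²`
  obtain ⟨τ, hτ⟩ := exists_algHom_sqrt_eq (y := -δ) hDsq hD1 hδ hF (by rw [neg_sq, hδ])
  have hconj : IsIntegral ℤ ((a : F) - b * δ) := by
    have h := hx.map (τ.restrictScalars ℤ)
    simpa [hτ, sub_eq_add_neg] using h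
  have htr : IsIntegral ℤ (2 * a) := by
    have h : IsIntegral ℤ (algebraMap ℚ F (2 * a)) := by
      convert! hx.add hconj using 1
      simp; ring
    exact (isIntegral_algebraMap_iff (algebraMap ℚ F).injective).mp h
  have hnorm : IsIntegral ℤ (a ^ 2 - D * b ^ 2) := by
    have h : IsIntegral ℤ (algebraMap ℚ F (a ^ 2 - D * b ^ 2)) := by
      convert! hx.mul hconj using 1
      simp; linear_combination (b : F) ^ 2 * hδ
    exact (isIntegral_algebraMap_iff (algebraMap ℚ F).injective).mp h
  obtain ⟨m, hm⟩ := IsIntegrallyClosed.isIntegral_iff.mp htr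
  obtain ⟨N, hN⟩ := IsIntegrallyClosed.isIntegral_iff.mp hnorm
  rw [eq_intCast] at hm hN
  obtain ⟨k, hk⟩ := hDsq.exists_int_eq_of_mul_sq (r := 2 * b) (N := m ^ 2 - 4 * N) (by
    push_cast; rw [hm, hN]; ring)
  have hmk : m ^ 2 - D * k ^ 2 = 4 * N := by
    have : (m : ℚ) ^ 2 - D * k ^ 2 = 4 * N := by rw [hm, hN, ← hk]; ring
    exact_mod_cast this
  obtain ⟨l, hl⟩ : ∃ l, m + k * s = 2 * l := by
    obtain ⟨e, he⟩ := hDmod.symm.dvd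
    have hD : D = 4 * e + 1 := by linarith
    have hev : Even (m ^ 2 + D * k ^ 2) := ⟨2 * N + D * k ^ 2, by linarith⟩
    have hDodd : Odd D := ⟨2 * e, by linarith⟩
    rw [← even_iff_exists_two_mul]
    rw [Int.even_add, Int.even_mul, Int.even_pow' two_ne_zero, Int.even_pow' two_ne_zero] at hev
    rw [Int.even_add, Int.even_mul]
    rw [← Int.not_even_iff_odd] at hs hDodd
    tauto
  refine ⟨l, k, ?_⟩
  have hm' : (m : F) = 2 * a := by exact_mod_cast congrArg (Rat.cast (K := F)) hm
  have hk' : (2 * b : F) = k := by exact_mod_cast congrArg (Rat.cast (K := F)) hk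
  have hl' : (m + k * s : F) = 2 * l := by exact_mod_cast congrArg (Int.cast (R := F)) hl
  linear_combination (1 / 2 : F) * hl' - (1 / 2 : F) * hm' + (δ / 2) * hk'

/-- The real embeddings of `ℚ(√D)` are the two given by `±√D`. -/
theorem exists_real_embeddings (hDpos : 0 < D) (hDsq : Squarefree D) (hD1 : D ≠ 1)
    (hδ : δ ^ 2 = (D : F)) (hF : IntermediateField.adjoin ℚ {δ} = ⊤) :
    ∃ σ₁ σ₂ : F →+* ℝ, σ₁ δ = √D ∧ σ₂ δ = -√D ∧ σ₁ ≠ σ₂ ∧ ∀ σ, σ = σ₁ ∨ σ = σ₂ := by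
  have hDR : (0 : ℝ) < D := by exact_mod_cast hDpos
  obtain ⟨σ₁, h₁⟩ := exists_algHom_sqrt_eq (y := √(D : ℝ)) hDsq hD1 hδ hF (Real.sq_sqrt hDR.le)
  obtain ⟨σ₂, h₂⟩ := exists_algHom_sqrt_eq (y := -√(D : ℝ)) hDsq hD1 hδ hF (by
    rw [neg_sq, Real.sq_sqrt hDR.le])
  have hext : ∀ f g : F →+* ℝ, f δ = g δ → f = g := by
    intro f g h
    ext x
    obtain ⟨a, b, rfl⟩ := exists_rat_add_rat_mul_sqrt hδ hF x
    simp [h]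
  refine ⟨σ₁, σ₂, h₁, h₂, fun h => ?_, fun σ => ?_⟩
  · have := DFunLike.congr_fun h δ
    have h0 : 0 < √(D : ℝ) := Real.sqrt_pos.mpr hDR
    simp only [RingHom.coe_coe, h₁, h₂] at this
    linarith
  · have h : σ δ ^ 2 = √(D : ℝ) ^ 2 := by
      rw [← map_pow, hδ, Real.sq_sqrt hDR.le, map_intCast]
    rcases sq_eq_sq_iff_eq_or_eq_neg.mp h with h | h
    · exact .inl (hext _ _ (h.trans h₁.symm))
    · exact .inr (hext _ _ (h.trans h₂.symm))

end QuadraticField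

/-! ### Maximality of the standard order -/

/-- An integral element of a quaternion algebra has an integral reduced trace: it is either a
scalar, or its minimal polynomial is its reduced characteristic polynomial. -/
theorem QuaternionAlgebra.isIntegral_two_mul_re {F R : Type*} [Field F] [CommRing R] [Algebra R F]
    {a b : F} {x : ℍ[F,a,b]} (hx : IsIntegral R x) : IsIntegral R (2 * x.re) := by
  obtain ⟨p, hp, hpx⟩ := hx
  have hpF : Polynomial.aeval x (p.map (algebraMap R F)) = 0 := by
    rw [Polynomial.aeval_map_algebraMap]; exact hpx
  by_cases hxF : x ∈ (algebraMap F ℍ[F,a,b]).range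
  · obtain ⟨r, rfl⟩ := hxF
    have hr : IsIntegral R r := ⟨p, hp, by
      rw [Polynomial.aeval_algebraMap_apply] at hpF
      have := (map_eq_zero_iff _ QuaternionAlgebra.algebraMap_injective).mp hpF
      rwa [Polynomial.aeval_map_algebraMap] at this⟩
    have : IsIntegral R (r + r) := hr.add hr
    rw [QuaternionAlgebra.algebraMap_eq]
    simpa [two_mul] using this
  · let n : F := x.re ^ 2 - a * x.imI ^ 2 - b * x.imJ ^ 2 + a * b * x.imK ^ 2
    let q : Polynomial F := 
      Polynomial.X ^ 2 + (Polynomial.C (-(2 * x.re)) * Polynomial.X + Polynomial.C n)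
    have hdeg : (Polynomial.C (-(2 * x.re)) * Polynomial.X + Polynomial.C n).degree < 2 :=
      Polynomial.degree_linear_lt
    have hq : q.Monic := Polynomial.monic_X_pow_add hdeg
    have hqdeg : q.natDegree = 2 := by
      apply Polynomial.natDegree_eq_of_degree_eq_some
      rw [Polynomial.degree_add_eq_left_of_degree_lt (by simpa using hdeg)]
      simp
    have hqx : Polynomial.aeval x q = 0 := by
      simp only [q, map_add, map_mul, Polynomial.aeval_X, Polynomial.aeval_C,
        QuaternionAlgebra.algebraMap_eq, sq, n]
      ext <;> simp <;> ring
    have hxint : IsIntegral F x := ⟨q, hq, hqx⟩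
    have hmin : minpoly F x = q :=
      (Polynomial.eq_of_monic_of_dvd_of_natDegree_le (minpoly.monic hxint) hq
        (minpoly.dvd F x hqx) (hqdeg ▸ (minpoly.two_le_natDegree_iff hxint).mpr hxF)).symm
    have h := Polynomial.isIntegral_coeff_of_dvd p q hp hq (hmin ▸ minpoly.dvd F x hpF) 1
    have hc : q.coeff 1 = -(2 * x.re) := by
      simp [q, Polynomial.coeff_X_pow]
    rw [hc] at h
    simpa using h.neg

/-- The elements of an order are integral, hence so are their reduced traces. -/
theorem IsQuaternionOrder.isIntegral_two_mul_re {F : Type*} [Field F] {a b : F}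
    {O : Submodule (𝓞 F) ℍ[F,a,b]} (hO : IsQuaternionOrder O) {x : ℍ[F,a,b]} (hx : x ∈ O) :
    ∃ r : 𝓞 F, (r : F) = 2 * x.re := by
  let S : Subalgebra (𝓞 F) ℍ[F,a,b] :=
    { O with
      mul_mem' := fun {x y} hx hy => hO.mul_mem x hx y hy
      one_mem' := hO.one_mem
      algebraMap_mem' := fun r => by
        rw [Algebra.algebraMap_eq_smul_one]; exact O.smul_mem r hO.one_mem }
  have hS : Subalgebra.toSubmodule S = O := rfl
  have hint : IsIntegral (𝓞 F) x := .of_mem_of_fg S (hS ▸ hO.fg) x hx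
  exact IsIntegralClosure.isIntegral_iff (A := 𝓞 F).mp
    (isIntegral_trans (R := ℤ) (A := 𝓞 F) _ (QuaternionAlgebra.isIntegral_two_mul_re hint))

section StandardOrder

variable {F : Type*} [Field F] {D : ℤ} {δ : F}

/-- For `D = 8 n + 5` the element `w = (1 + √D) / 2` is an algebraic integer, and it
satisfies `w ^ 2 = w + 1` modulo `2`. -/
theorem exists_integer_eq_half_one_add_sqrt [CharZero F] (hδ : δ ^ 2 = (D : F)) {n : ℤ}
    (hn : D = 8 * n + 5) :
    ∃ w : 𝓞 F, (w : F) = (δ + 1) / 2 ∧ (w : F) ^ 2 = w + (2 * n + 1) := by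
  have hn' : (D : F) = 8 * n + 5 := by exact_mod_cast congrArg (Int.cast (R := F)) hn
  have h : ((δ + 1) / 2) ^ 2 = (δ + 1) / 2 + (2 * n + 1) := by
    linear_combination (hδ + hn') / 4
  have hint : IsIntegral ℤ ((δ + 1) / 2) := by
    refine ⟨Polynomial.X ^ 2 + (Polynomial.C (-1) * Polynomial.X + Polynomial.C (-(2 * n + 1))),
      Polynomial.monic_X_pow_add Polynomial.degree_linear_lt, ?_⟩
    simp only [Polynomial.eval₂_add, Polynomial.eval₂_mul, Polynomial.eval₂_pow,
      Polynomial.eval₂_X, Polynomial.eval₂_C, h]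
    simp
    ring
  exact ⟨⟨_, hint⟩, rfl, h⟩

/-- The elements of the standard order for `D ≢ 1 (mod 8)`, in coordinates: with
`w = (1 + δ) / 2` the last two basis vectors are `(w + (w + 1) i + j) / 2` and
`((w + 1) + w i + k) / 2`. -/
theorem mem_standardOrder_iff [CharZero F] (hD8 : ¬ D ≡ 1 [ZMOD 8]) {w : 𝓞 F}
    (hw : (w : F) = (δ + 1) / 2) {q : ℍ[F,-1,-1]} :
    q ∈ standardOrder D δ ↔ ∃ a b c e : 𝓞 F,
      q = ⟨a + (c * w + e * (w + 1)) / 2, b + (c * (w + 1) + e * w) / 2, c / 2, e / 2⟩ := by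
  have key : ∀ a b c e : 𝓞 F, ∑ i, ![a, b, c, e] i • orderBasis D δ i =
      ⟨a + (c * w + e * (w + 1)) / 2, b + (c * (w + 1) + e * w) / 2, c / 2, e / 2⟩ := by
    intro a b c e
    rw [Fin.sum_univ_four, hw]
    simp only [orderBasis, if_neg hD8]
    ext <;> simp [Algebra.smul_def] <;> ring
  rw [standardOrder, Submodule.mem_span_range_iff_exists_fun]
  constructor
  · rintro ⟨c, rfl⟩
    refine ⟨c 0, c 1, c 2, c 3, ?_⟩
    rw [← key]
    refine Finset.sum_congr rfl fun i _ => ?_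
    fin_cases i <;> rfl
  · rintro ⟨a, b, c, e, rfl⟩
    exact ⟨_, key a b c e⟩

theorem isQuaternionOrder_standardOrder [CharZero F] (hδ : δ ^ 2 = (D : F)) {n : ℤ}
    (hn : D = 8 * n + 5) : IsQuaternionOrder (standardOrder D δ) := by
  obtain ⟨w, hw, hw2⟩ := exists_integer_eq_half_one_add_sqrt hδ hn
  have hD8 : ¬ D ≡ 1 [ZMOD 8] := by unfold Int.ModEq; omega
  refine ⟨Submodule.fg_span (Set.finite_range _), ?_, ?_, ?_⟩
  · rw [eq_top_iff]
    rintro ⟨x, y, z, t⟩ -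
    have h2 : ((2 : 𝓞 F) : F) = 2 := map_ofNat _ 2
    have h1 : (⟨1, 0, 0, 0⟩ : ℍ[F,-1,-1]) ∈ standardOrder D δ :=
      (mem_standardOrder_iff hD8 hw).mpr ⟨1, 0, 0, 0, by simp⟩
    have hi : (⟨0, 1, 0, 0⟩ : ℍ[F,-1,-1]) ∈ standardOrder D δ :=
      (mem_standardOrder_iff hD8 hw).mpr ⟨0, 1, 0, 0, by simp⟩
    have hj : (⟨0, 0, 1, 0⟩ : ℍ[F,-1,-1]) ∈ standardOrder D δ :=
      (mem_standardOrder_iff hD8 hw).mpr ⟨-w, -(w + 1), 2, 0, by simp [h2]⟩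
    have hk : (⟨0, 0, 0, 1⟩ : ℍ[F,-1,-1]) ∈ standardOrder D δ :=
      (mem_standardOrder_iff hD8 hw).mpr ⟨-(w + 1), -w, 0, 2, by simp [h2]⟩
    have hq : (⟨x, y, z, t⟩ : ℍ[F,-1,-1]) =
        x • ⟨1, 0, 0, 0⟩ + y • ⟨0, 1, 0, 0⟩ + z • ⟨0, 0, 1, 0⟩ + t • ⟨0, 0, 0, 1⟩ := by
      ext <;> simp
    rw [hq]
    exact add_mem (add_mem (add_mem
      (Submodule.smul_mem _ _ (Submodule.subset_span h1))
      (Submodule.smul_mem _ _ (Submodule.subset_span hi)))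
      (Submodule.smul_mem _ _ (Submodule.subset_span hj)))
      (Submodule.smul_mem _ _ (Submodule.subset_span hk))
  · refine (mem_standardOrder_iff hD8 hw).mpr ⟨1, 0, 0, 0, ?_⟩
    ext <;> simp
  · intro x hx y hy
    obtain ⟨a, b, c, e, rfl⟩ := (mem_standardOrder_iff hD8 hw).mp hx
    obtain ⟨a', b', c', e', rfl⟩ := (mem_standardOrder_iff hD8 hw).mp hy
    -- the coefficients come from the multiplication table of the basis `1, i, p, q`:
    -- `i p = q - (w + 1)`, `i q = -p + (w + 1) i`, `p i = -q + w i`, `q i = p - w`,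
    -- `p² = w p - (w + 1 + n)`, `q² = (w + 1) q - (w + 1 + n)`, `p q = (w + 1 + n) i` and
    -- `q p = w q - w (w + 1) - (w + 1 + n) i + (w + 1) p`
    refine (mem_standardOrder_iff hD8 hw).mpr
      ⟨a * a' - b * b' - b * c' * (w + 1) - c * c' * (w + 1 + n) - e * b' * w
          - e * c' * (w * (w + 1)) - e * e' * (w + 1 + n),
        a * b' + b * a' + b * e' * (w + 1) + c * b' * w + c * e' * (w + 1 + n)
          - e * c' * (w + 1 + n),
        a * c' - b * e' + c * a' + c * c' * w + e * b' + e * c' * (w + 1),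
        a * e' + b * c' - c * b' + e * a' + e * c' * w + e * e' * (w + 1), ?_⟩
    ext
    · simp
      grind
    · simp
      grind
    · simp
      grind
    · simp
      grind

/-- The standard order is maximal for `D ≡ 5 (mod 8)`, because it is self-dual with respect to
the reduced trace: an element `x` of a larger order has integral traces `trd (x y)`, where `y`
runs through the standard order, and this already forces `x` into the standard order. -/
theorem isMaximalQuaternionOrder_standardOrder [CharZero F] (hδ : δ ^ 2 = (D : F)) {n : ℤ}
    (hn : D = 8 * n + 5) : IsMaximalQuaternionOrder (standardOrder D δ) := by
  refine ⟨isQuaternionOrder_standardOrder hδ hn, fun O' hO' hle => le_antisymm hle ?_⟩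
  obtain ⟨w, hw, hw2⟩ := exists_integer_eq_half_one_add_sqrt hδ hn
  have hD8 : ¬ D ≡ 1 [ZMOD 8] := by unfold Int.ModEq; omega
  intro x hx
  have trd : ∀ a b c e : 𝓞 F, ∃ r : 𝓞 F, (r : F) =
      2 * (x * ⟨a + (c * w + e * (w + 1)) / 2, b + (c * (w + 1) + e * w) / 2,
        c / 2, e / 2⟩).re := fun a b c e =>
    hO'.isIntegral_two_mul_re (hO'.mul_mem x hx _
      (hle ((mem_standardOrder_iff hD8 hw).mpr ⟨a, b, c, e, rfl⟩)))
  -- the traces of `x`, `x i`, `x p`, `x q` for the basis `1, i, p, q`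
  obtain ⟨r, hr⟩ := trd 1 0 0 0
  obtain ⟨u, hu⟩ := trd 0 1 0 0
  obtain ⟨y, hy⟩ := trd 0 0 1 0
  obtain ⟨z, hz⟩ := trd 0 0 0 1
  obtain ⟨x0, x1, x2, x3⟩ := x
  have h2 : ((2 : 𝓞 F) : F) = 2 := map_ofNat _ 2
  simp at hr hu hy hz
  refine (mem_standardOrder_iff hD8 hw).mpr
    ⟨y * w + z * (w + 1) - (r + u) * (w * (w + 1)),
      y * (w + 1) + z * w - (r + u) * (w * (w + 1)) - u,
      r * w + u * (w + 1) - 2 * y, r * (w + 1) + u * w - 2 * z, ?_⟩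
  ext
  · simp [h2]
    grind
  · simp [h2]
    grind
  · simp [h2]
    grind
  · simp [h2]
    grind

end StandardOrder

/-! ### The lattice `E₈` and the Hamming code -/

/-- The integral vectors of length `8` whose reduction modulo `2` lies in the extended Hamming code
of length `8`: the sums over the four coordinate pairs `{2 k, 2 k + 1}` have the same parity, and
the sum of the coordinates with even index is even. -/
def IsHammingVector (Y : Fin 8 → ℤ) : Prop :=
  2 ∣ Y 0 + Y 1 + Y 2 + Y 3 ∧ 2 ∣ Y 0 + Y 1 + Y 4 + Y 5 ∧ 2 ∣ Y 0 + Y 1 + Y 6 + Y 7 ∧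
    2 ∣ Y 0 + Y 2 + Y 4 + Y 6

/-- The `8` vectors `e_(2 k) + e_(2 k + 1)` and `e_(2 k) - e_(2 k + 1)`, for `k = 0, …, 3`, in this
order for each `k`. -/
def pairVector : Fin 8 → Fin 8 → ℤ :=
  ![![1, 1, 0, 0, 0, 0, 0, 0], ![1, -1, 0, 0, 0, 0, 0, 0],
    ![0, 0, 1, 1, 0, 0, 0, 0], ![0, 0, 1, -1, 0, 0, 0, 0],
    ![0, 0, 0, 0, 1, 1, 0, 0], ![0, 0, 0, 0, 1, -1, 0, 0],
    ![0, 0, 0, 0, 0, 0, 1, 1], ![0, 0, 0, 0, 0, 0, 1, -1]]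

/-- The vectors `e_(2 k) ± e_(2 k + 1)` are orthogonal, of square length `2`. -/
theorem sum_pairVector_mul_pairVector (i j : Fin 8) :
    ∑ k, pairVector i k * pairVector j k = if i = j then 2 else 0 := by
  revert i j; decide

/-- Construction A: the integral vectors reducing to the extended Hamming code, with the standard
inner product scaled by `1 / 2`, form a lattice isometric to `E₈`. The isometry takes as
orthonormal basis the images of the vectors `e_(2 k) ± e_(2 k + 1)`. -/
theorem isSimilarLattice_latticeE8_of_isHammingVector {V : Type*} [NormedAddCommGroup V]
    [InnerProductSpace ℝ V] (hV : Module.finrank ℝ V = 8) {Λ : AddSubgroup V}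
    (W : (Fin 8 → ℤ) → V) (hW : ∀ Y Z, inner ℝ (W Y) (W Z) = ((∑ i, Y i * Z i : ℤ) : ℝ) / 2)
    (hΛ : ∀ v, v ∈ Λ ↔ ∃ Y, IsHammingVector Y ∧ W Y = v) : IsSimilarLattice Λ latticeE8 := by
  have : FiniteDimensional ℝ V := .of_finrank_pos (by simp [hV])
  have hon : Orthonormal ℝ (fun i => W (pairVector i)) := by
    rw [orthonormal_iff_ite]
    intro i j
    rw [hW, sum_pairVector_mul_pairVector]
    split_ifs <;> simp
  let b : OrthonormalBasis (Fin 8) ℝ V := OrthonormalBasis.mk hon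
    (hon.linearIndependent.span_eq_top_of_card_eq_finrank' (by simp [hV])).ge
  have hb : ∀ Y i, b.repr (W Y) i = ((∑ k, pairVector i k * Y k : ℤ) : ℝ) / 2 := by
    intro Y i
    rw [b.repr_apply_apply, ← hW]
    simp [b]
  refine ⟨1, one_pos, b.repr, ?_⟩
  ext x
  simp only [one_smul, Set.mem_image, SetLike.mem_coe, hΛ]
  constructor
  · rintro ⟨_, ⟨Y, ⟨⟨a, ha⟩, ⟨c, hc⟩, ⟨d, hd⟩, ⟨e, he⟩⟩, rfl⟩, rfl⟩
    refine ⟨?_, ?_⟩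
    · -- the common parity of the pair sums decides between integers and half-integers
      rcases Int.even_or_odd' (Y 0 + Y 1) with ⟨p, hp | hp⟩
      · left
        have h : ∀ i, 2 ∣ ∑ k, pairVector i k * Y k := by
          intro i
          simp only [Fin.sum_univ_eight]
          fin_cases i <;> simp [pairVector] <;> omega
        intro i
        obtain ⟨m, hm⟩ := h i
        exact ⟨m, by rw [hb, hm]; push_cast; ring⟩
      · right
        have h : ∀ i, 2 ∣ ∑ k, pairVector i k * Y k - 1 := by
          intro i
          simp only [Fin.sum_univ_eight]
          fin_cases i <;> simp [pairVector] <;> omega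
        intro i
        obtain ⟨m, hm⟩ := h i
        exact ⟨m, by rw [hb, sub_eq_iff_eq_add.mp hm]; push_cast; ring⟩
    · refine ⟨e, ?_⟩
      have he' : (Y 0 + Y 2 + Y 4 + Y 6 : ℝ) = 2 * e := by exact_mod_cast he
      rw [← he']
      simp only [hb, Fin.sum_univ_eight]
      simp [pairVector]
      ring
  · rintro ⟨hx, n, hn⟩
    rw [Fin.sum_univ_eight] at hn
    rcases hx with hx | hx
    · choose m hm using hx
      simp only [hm] at hn
      norm_cast at hn
      refine ⟨_, ⟨![m 0 + m 1, m 0 - m 1, m 2 + m 3, m 2 - m 3, m 4 + m 5, m 4 - m 5,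
        m 6 + m 7, m 6 - m 7], ?_, rfl⟩, ?_⟩
      · simp [IsHammingVector]; omega
      · ext i
        rw [hb, hm]
        simp only [Fin.sum_univ_eight]
        fin_cases i <;> simp [pairVector] <;> ring
    · choose m hm using hx
      simp only [hm] at hn
      have hn' : m 0 + m 1 + m 2 + m 3 + m 4 + m 5 + m 6 + m 7 + 4 = 2 * n := by
        have : (m 0 + m 1 + m 2 + m 3 + m 4 + m 5 + m 6 + m 7 + 4 : ℝ) = 2 * n := by
          rw [← hn]; ring
        exact_mod_cast this
      refine ⟨_, ⟨![m 0 + m 1 + 1, m 0 - m 1, m 2 + m 3 + 1, m 2 - m 3, m 4 + m 5 + 1, m 4 - m 5,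
        m 6 + m 7 + 1, m 6 - m 7], ?_, rfl⟩, ?_⟩
      · simp [IsHammingVector]; omega
      · ext i
        rw [hb, hm]
        simp only [Fin.sum_univ_eight]
        fin_cases i <;> simp [pairVector] <;> ring

theorem span_latticeE8 : Submodule.span ℝ (latticeE8 : Set (EuclideanSpace ℝ (Fin 8))) = ⊤ := by
  rw [eq_top_iff, ← (EuclideanSpace.basisFun (Fin 8) ℝ).toBasis.span_eq, Submodule.span_le]
  rintro _ ⟨i, rfl⟩
  have h : EuclideanSpace.single i (2 : ℝ) ∈ latticeE8 := by
    refine ⟨.inl fun j => ⟨if j = i then 2 else 0, ?_⟩, 1, ?_⟩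
    · simp
    · simp
  have h2 := Submodule.smul_mem _ (1 / 2 : ℝ) (Submodule.subset_span (R := ℝ) h)
  convert! h2 using 1
  ext j
  simp

/-- A lattice similar to one that spans its ambient space spans its ambient space. -/
theorem IsSimilarLattice.span_eq_top {V W : Type*} [NormedAddCommGroup V] [InnerProductSpace ℝ V]
    [NormedAddCommGroup W] [InnerProductSpace ℝ W] {Λ : AddSubgroup V} {Λ' : AddSubgroup W}
    (h : IsSimilarLattice Λ Λ') (hΛ' : Submodule.span ℝ (Λ' : Set W) = ⊤) :
    Submodule.span ℝ (Λ : Set V) = ⊤ := by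
  obtain ⟨c, -, f, hf⟩ := h
  have hle : Submodule.span ℝ (Λ' : Set W) ≤
      (Submodule.span ℝ (Λ : Set V)).map f.toLinearEquiv.toLinearMap := by
    rw [Submodule.span_le, ← hf]
    rintro _ ⟨x, hx, rfl⟩
    exact Submodule.smul_mem _ c (Submodule.mem_map_of_mem (Submodule.subset_span hx))
  rw [hΛ', top_le_iff] at hle
  rw [eq_top_iff]
  intro x _
  obtain ⟨y, hy, hyx⟩ : f x ∈ (Submodule.span ℝ (Λ : Set V)).map f.toLinearEquiv.toLinearMap :=
    hle ▸ Submodule.mem_top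
  rwa [← f.injective hyx]

/-! ### The twisted embedding -/

section Twisted

variable {F : Type*} [Field F]

/-- The rows of the twisted matrix are the images of the products `ω_r β_s`, which generate the
`𝓞 F`-span of the `β_s` as an abelian group. -/
theorem closure_twistedMatrix {a b : F} {n : ℕ} (ω : Module.Basis (Fin n) ℤ (𝓞 F))
    (β : Fin 4 → ℍ[F,a,b]) (α : F) :
    AddSubgroup.closure (Set.range fun r => (WithLp.toLp 2 (twistedMatrix ω β α r) :
      EuclideanSpace ℝ (Fin 4 × (F →+* ℝ)))) =
      twistedLattice (Submodule.span (𝓞 F) (Set.range β)) α := by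
  have hrow : ∀ r, WithLp.toLp 2 (twistedMatrix ω β α r) =
      twistedEmbedding α (ω r.2 • β r.1) := by
    rintro ⟨i, r⟩
    ext ⟨l, σ⟩
    fin_cases l <;> rfl
  simp only [hrow]
  apply le_antisymm
  · rw [AddSubgroup.closure_le]
    rintro _ ⟨r, rfl⟩
    exact AddSubgroup.mem_map_of_mem _
      (Submodule.smul_mem _ _ (Submodule.subset_span (Set.mem_range_self _)))
  · rintro _ ⟨q, hq, rfl⟩
    obtain ⟨c, rfl⟩ := (Submodule.mem_span_range_iff_exists_fun _).mp hq
    rw [map_sum]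
    refine sum_mem fun i _ => ?_
    rw [← ω.sum_repr (c i), Finset.sum_smul, map_sum]
    refine sum_mem fun r _ => ?_
    rw [smul_assoc, map_zsmul]
    exact zsmul_mem (AddSubgroup.subset_closure (Set.mem_range_self (i, r))) _

/-- If the twisted lattice spans an ambient space whose dimension is the number of rows, then the
generating rows of the twisted matrix are linearly independent. -/
theorem isGeneratorMatrix_twistedMatrix [NumberField F] {a b : F} {n : ℕ}
    (ω : Module.Basis (Fin n) ℤ (𝓞 F)) (β : Fin 4 → ℍ[F,a,b]) (α : F)
    (hcard : Fintype.card (F →+* ℝ) = n)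
    (hspan : Submodule.span ℝ (twistedLattice (Submodule.span (𝓞 F) (Set.range β)) α :
      Set (EuclideanSpace ℝ (Fin 4 × (F →+* ℝ)))) = ⊤) :
    IsGeneratorMatrix (twistedMatrix ω β α)
      (twistedLattice (Submodule.span (𝓞 F) (Set.range β)) α) := by
  refine ⟨linearIndependent_of_top_le_span_of_card_eq_finrank ?_ (by simp [hcard]),
    closure_twistedMatrix ω β α⟩
  rw [← hspan, Submodule.span_le, ← closure_twistedMatrix ω β α]
  exact (AddSubgroup.closure_le (K := (Submodule.span ℝ _).toAddSubgroup)).mpr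
    Submodule.subset_span

end Twisted

/-! ### The standard order as a lattice for `D = s ^ 2 + 4` -/

section Standard

variable {F : Type*} [Field F] {D s t : ℤ} {δ : F}

/-- For `s = 2 t - 1`, the elements of the standard order in terms of their integral coordinates
with respect to the `ℤ`-basis `1, η` of the ring of integers, where `η = (δ - s) / 2`, so that
`η ^ 2 = 1 - s η`. -/
theorem mem_standardOrder_iff_exists_int [CharZero F] (hs : s = 2 * t - 1) (hDs : D = s ^ 2 + 4)
    (hD8 : ¬ D ≡ 1 [ZMOD 8]) (hδ : δ ^ 2 = (D : F)) {w : 𝓞 F} (hw : (w : F) = (δ + 1) / 2)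
    (hint : ∀ x : 𝓞 F, ∃ m n : ℤ, (x : F) = m + n * ((δ - s) / 2)) {q : ℍ[F,-1,-1]} :
    q ∈ standardOrder D δ ↔ ∃ a₀ a₁ b₀ b₁ c₀ c₁ d₀ d₁ : ℤ,
      (2 ∣ a₀ - (t * (c₀ + d₀) + c₁ + d₁ + d₀) ∧
        2 ∣ a₁ - (c₀ + d₀ + (1 - t) * (c₁ + d₁) + d₁) ∧
        2 ∣ b₀ - (t * (c₀ + d₀) + c₁ + d₁ + c₀) ∧
        2 ∣ b₁ - (c₀ + d₀ + (1 - t) * (c₁ + d₁) + c₁)) ∧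
      q = ⟨(a₀ + a₁ * ((δ - s) / 2)) / 2, (b₀ + b₁ * ((δ - s) / 2)) / 2,
        (c₀ + c₁ * ((δ - s) / 2)) / 2, (d₀ + d₁ * ((δ - s) / 2)) / 2⟩ := by
  have hw' : (w : F) = (δ - s) / 2 + t := by rw [hw, hs]; push_cast; ring
  have hη : ((δ - s) / 2) ^ 2 = 1 - s * ((δ - s) / 2) := by
    have : (D : F) = s ^ 2 + 4 := by exact_mod_cast congrArg (Int.cast (R := F)) hDs
    linear_combination (hδ + this) / 4
  have hs' : (s : F) = 2 * t - 1 := by rw [hs]; push_cast; ring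
  have hwη : ((w - t : 𝓞 F) : F) = (δ - s) / 2 := by
    have ht : ((t : 𝓞 F) : F) = t := map_intCast (algebraMap (𝓞 F) F) t
    rw [show ((w - t : 𝓞 F) : F) = w - (t : 𝓞 F) from rfl, ht, hw']; ring
  rw [mem_standardOrder_iff hD8 hw]
  constructor
  · rintro ⟨a, b, c, e, rfl⟩
    obtain ⟨a₀, a₁, ha⟩ := hint a
    obtain ⟨b₀, b₁, hb⟩ := hint b
    obtain ⟨c₀, c₁, hc⟩ := hint c
    obtain ⟨d₀, d₁, hd⟩ := hint e
    refine ⟨2 * a₀ + (t * (c₀ + d₀) + c₁ + d₁ + d₀),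
      2 * a₁ + (c₀ + d₀ + (1 - t) * (c₁ + d₁) + d₁),
      2 * b₀ + (t * (c₀ + d₀) + c₁ + d₁ + c₀),
      2 * b₁ + (c₀ + d₀ + (1 - t) * (c₁ + d₁) + c₁), c₀, c₁, d₀, d₁,
      ⟨⟨a₀, by ring⟩, ⟨a₁, by ring⟩, ⟨b₀, by ring⟩, ⟨b₁, by ring⟩⟩, ?_⟩
    rw [ha, hb, hc, hd, hw']
    generalize (δ - s) / 2 = η at *
    ext
    · push_cast
      linear_combination (c₁ + d₁) / 2 * hη - (c₁ + d₁) / 2 * η * hs'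
    · push_cast
      linear_combination (c₁ + d₁) / 2 * hη - (c₁ + d₁) / 2 * η * hs'
    · rfl
    · rfl
  · rintro ⟨a₀, a₁, b₀, b₁, c₀, c₁, d₀, d₁, ⟨⟨a₀', h₁⟩, ⟨a₁', h₂⟩, ⟨b₀', h₃⟩, ⟨b₁', h₄⟩⟩, rfl⟩
    refine ⟨a₀' + a₁' * (w - t), b₀' + b₁' * (w - t), c₀ + c₁ * (w - t), d₀ + d₁ * (w - t), ?_⟩
    have hcoe : ∀ m n : ℤ, ((m + n * (w - t) : 𝓞 F) : F) = m + n * ((δ - s) / 2) := by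
      intro m n
      rw [← hwη]
      simp
    simp only [hcoe, hw']
    rw [sub_eq_iff_eq_add] at h₁ h₂ h₃ h₄
    rw [h₁, h₂, h₃, h₄]
    generalize (δ - s) / 2 = η at *
    ext
    · push_cast
      linear_combination -(c₁ + d₁) / 2 * hη + (c₁ + d₁) / 2 * η * hs'
    · push_cast
      linear_combination -(c₁ + d₁) / 2 * hη + (c₁ + d₁) / 2 * η * hs'
    · rfl
    · rfl

/-- With respect to the basis `1, η = (δ - s) / 2` of the ring of integers, the twisted trace form
`Tr (2 α x y)` is twice the standard inner product. Here it is evaluated at two halved vectors;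
the two summands belong to the real embeddings `δ ↦ r` and `δ ↦ -r`. -/
theorem twisted_trace_form {r s : ℝ} (hr0 : r ≠ 0) (hr : r ^ 2 = s ^ 2 + 4) (x₀ x₁ y₀ y₁ : ℝ) :
    2 * ((s + r) / 2 / r) * ((x₀ + x₁ * ((r - s) / 2)) / 2) * ((y₀ + y₁ * ((r - s) / 2)) / 2) +
      2 * ((s + -r) / 2 / -r) * ((x₀ + x₁ * ((-r - s) / 2)) / 2) *
        ((y₀ + y₁ * ((-r - s) / 2)) / 2) = (x₀ * y₀ + x₁ * y₁) / 2 := by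
  field_simp
  have hs : s ^ 2 = r ^ 2 - 4 := by linarith
  ring_nf
  grind

theorem inner_twistedEmbedding [NumberField F] {a b : F} {α : F}
    (hα : ∀ σ : F →+* ℝ, 0 < σ α) (p q : ℍ[F,a,b]) :
    inner ℝ (twistedEmbedding α p) (twistedEmbedding α q) =
      ∑ l, ∑ σ : F →+* ℝ, 2 * σ α * σ (quaternionCoord p l) * σ (quaternionCoord q l) := by
  rw [PiLp.inner_apply, Fintype.sum_prod_type]
  refine Finset.sum_congr rfl fun l _ => Finset.sum_congr rfl fun σ _ => ?_
  have h := Real.mul_self_sqrt (mul_pos two_pos (hα σ)).le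
  simp only [twistedEmbedding, AddMonoidHom.coe_mk, ZeroHom.coe_mk, RCLike.inner_apply,
    conj_trivial]
  linear_combination (σ (quaternionCoord p l) * σ (quaternionCoord q l)) * h

/-- The integral coordinates with respect to `1, η`, taken in a suitable order, identify the twisted
standard order with the lattice obtained from the extended Hamming code by construction A. -/
theorem isSimilarLattice_twistedLattice_standardOrder [NumberField F] (hs : s = 2 * t - 1)
    (hDs : D = s ^ 2 + 4) (hD8 : ¬ D ≡ 1 [ZMOD 8]) (hδ : δ ^ 2 = (D : F)) {w : 𝓞 F}
    (hw : (w : F) = (δ + 1) / 2)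
    (hint : ∀ x : 𝓞 F, ∃ m n : ℤ, (x : F) = m + n * ((δ - s) / 2)) {α : F}
    (hα : ∀ σ : F →+* ℝ, 0 < σ α) (hαeq : α = ((s + δ) / 2) / δ) {σ₁ σ₂ : F →+* ℝ}
    (h₁ : σ₁ δ = √D) (h₂ : σ₂ δ = -√D) (hne : σ₁ ≠ σ₂) (hσ : ∀ σ, σ = σ₁ ∨ σ = σ₂) :
    IsSimilarLattice (twistedLattice (standardOrder D δ) α) latticeE8 := by
  have hDR : (D : ℝ) = s ^ 2 + 4 := by exact_mod_cast congrArg (Int.cast (R := ℝ)) hDs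
  have hr : √(D : ℝ) ^ 2 = s ^ 2 + 4 := by rw [Real.sq_sqrt (by rw [hDR]; positivity), hDR]
  have hr0 : √(D : ℝ) ≠ 0 := by rw [Real.sqrt_ne_zero', hDR]; positivity
  -- a sum over the real embeddings has the two summands for `σ₁` and `σ₂`
  have hsum : ∀ f : (F →+* ℝ) → ℝ, ∑ σ, f σ = f σ₁ + f σ₂ := by
    classical
    intro f
    rw [← Finset.sum_pair hne]
    refine Finset.sum_congr ?_ fun _ _ => rfl
    ext σ
    simpa using hσ σ
  have hfin : Module.finrank ℝ (EuclideanSpace ℝ (Fin 4 × (F →+* ℝ))) = 8 := by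
    have h : (Fintype.card (F →+* ℝ) : ℝ) = 2 := by
      have := hsum fun _ => 1
      rw [Finset.sum_const, Finset.card_univ] at this
      norm_num at this
      exact this
    have h' : Fintype.card (F →+* ℝ) = 2 := by exact_mod_cast h
    simp [h']
  have hform : ∀ x₀ x₁ y₀ y₁ : ℤ, ∑ σ : F →+* ℝ, 2 * σ α *
      σ ((x₀ + x₁ * ((δ - s) / 2)) / 2) * σ ((y₀ + y₁ * ((δ - s) / 2)) / 2) =
        ((x₀ * y₀ + x₁ * y₁ : ℤ) : ℝ) / 2 := by
    intro x₀ x₁ y₀ y₁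
    rw [hsum, hαeq]
    simp only [map_add, map_mul, map_div₀, map_sub, map_intCast, map_ofNat, h₁, h₂]
    rw [twisted_trace_form hr0 hr]
    push_cast
    ring
  have hmem : ∀ v, v ∈ twistedLattice (standardOrder D δ) α ↔
      ∃ q ∈ standardOrder D δ, twistedEmbedding α q = v := fun v => Iff.rfl
  -- the binary code of the integral coordinates modulo `2` depends on the parity of `t`;
  -- the two cases differ by an exchange of the first two coordinates
  rcases Int.even_or_odd' t with ⟨u, rfl | rfl⟩
  · refine isSimilarLattice_latticeE8_of_isHammingVector hfin (fun Y =>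
      twistedEmbedding (a := -1) (b := -1) α
      ⟨(Y 7 + Y 2 * ((δ - s) / 2)) / 2, (Y 6 + Y 4 * ((δ - s) / 2)) / 2,
        (Y 0 + Y 3 * ((δ - s) / 2)) / 2, (Y 1 + Y 5 * ((δ - s) / 2)) / 2⟩) ?_ ?_
    · intro Y Z
      simp only [inner_twistedEmbedding hα, Fin.sum_univ_four, Fin.sum_univ_eight]
      simp only [quaternionCoord, Matrix.cons_val, hform]
      push_cast
      ring
    · intro v
      simp only [hmem, mem_standardOrder_iff_exists_int hs hDs hD8 hδ hw hint]
      constructor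
      · rintro ⟨_, ⟨a₀, a₁, b₀, b₁, c₀, c₁, d₀, d₁, h, rfl⟩, rfl⟩
        refine ⟨![c₀, d₀, a₁, c₁, b₁, d₁, b₀, a₀], ?_, rfl⟩
        simp only [mul_assoc, sub_mul] at h
        generalize u * (c₀ + d₀) = z₁ at h
        generalize u * (c₁ + d₁) = z₂ at h
        simp only [IsHammingVector, Matrix.cons_val]
        omega
      · rintro ⟨Y, hY, rfl⟩
        refine ⟨_, ⟨Y 7, Y 2, Y 6, Y 4, Y 0, Y 3, Y 1, Y 5, ?_, rfl⟩, rfl⟩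
        simp only [IsHammingVector] at hY
        simp only [mul_assoc, sub_mul]
        generalize u * (Y 0 + Y 1) = z₁
        generalize u * (Y 3 + Y 5) = z₂
        omega
  · refine isSimilarLattice_latticeE8_of_isHammingVector hfin (fun Y =>
      twistedEmbedding (a := -1) (b := -1) α
      ⟨(Y 6 + Y 4 * ((δ - s) / 2)) / 2, (Y 7 + Y 2 * ((δ - s) / 2)) / 2,
        (Y 0 + Y 3 * ((δ - s) / 2)) / 2, (Y 1 + Y 5 * ((δ - s) / 2)) / 2⟩) ?_ ?_
    · intro Y Z
      simp only [inner_twistedEmbedding hα, Fin.sum_univ_four, Fin.sum_univ_eight]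
      simp only [quaternionCoord, Matrix.cons_val, hform]
      push_cast
      ring
    · intro v
      simp only [hmem, mem_standardOrder_iff_exists_int hs hDs hD8 hδ hw hint]
      constructor
      · rintro ⟨_, ⟨a₀, a₁, b₀, b₁, c₀, c₁, d₀, d₁, h, rfl⟩, rfl⟩
        refine ⟨![c₀, d₀, b₁, c₁, a₁, d₁, a₀, b₀], ?_, rfl⟩
        simp only [mul_assoc, sub_mul, add_mul] at h
        generalize u * (c₀ + d₀) = z₁ at h
        generalize u * (c₁ + d₁) = z₂ at h
        simp only [IsHammingVector, Matrix.cons_val]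
        omega
      · rintro ⟨Y, hY, rfl⟩
        refine ⟨_, ⟨Y 6, Y 4, Y 7, Y 2, Y 0, Y 3, Y 1, Y 5, ?_, rfl⟩, rfl⟩
        simp only [IsHammingVector] at hY
        simp only [mul_assoc, sub_mul, add_mul]
        generalize u * (Y 0 + Y 1) = z₁
        generalize u * (Y 3 + Y 5) = z₂
        omega

end Standard

theorem mainTheorem1 {F : Type*} [Field F] [NumberField F] (D s : ℤ) (δ : F)
    (hDpos : 0 < D) (hDsq : Squarefree D) (hDmod : D ≡ 1 [ZMOD 4]) (hDs : D = s ^ 2 + 4)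
    (hδ : δ ^ 2 = (D : F)) (hF : IntermediateField.adjoin ℚ {δ} = ⊤)
    (ε α : F) (hε : ε = ((s : F) + δ) / 2) (hα : α = ε / δ) :
    IsMaximalQuaternionOrder (standardOrder D δ) ∧
    IsTotallyPositive α ∧
    IsSimilarLattice (twistedLattice (standardOrder D δ) α) latticeE8 ∧
    ∀ ω : Module.Basis (Fin 2) ℤ (𝓞 F),
      IsGeneratorMatrix (twistedMatrix ω (orderBasis D δ) α)
        (twistedLattice (standardOrder D δ) α) := by
  have hD1 : D ≠ 1 := by have := sq_nonneg s; omega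
  have hsodd : Odd s := by
    by_contra h
    obtain ⟨m, rfl⟩ := even_iff_exists_two_mul.mp (Int.not_odd_iff_even.mp h)
    have h4 : D = 4 * (m ^ 2 + 1) := by rw [hDs]; ring
    unfold Int.ModEq at hDmod
    omega
  obtain ⟨t, rfl⟩ : ∃ t, s = 2 * t - 1 := by
    obtain ⟨m, rfl⟩ := hsodd
    exact ⟨m + 1, by ring⟩
  -- `D = (2 t - 1) ^ 2 + 4 = 4 t (t - 1) + 5`, and `t (t - 1)` is even
  obtain ⟨n, hn⟩ : ∃ n, D = 8 * n + 5 := by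
    obtain ⟨m, hm⟩ := even_iff_two_dvd.mp (Int.even_mul_pred_self t)
    exact ⟨m, by rw [hDs]; linear_combination 4 * hm⟩
  have hD8 : ¬ D ≡ 1 [ZMOD 8] := by unfold Int.ModEq; omega
  generalize hs : 2 * t - 1 = s at *
  obtain ⟨σ₁, σ₂, h₁, h₂, hne, hσ⟩ := exists_real_embeddings hDpos hDsq hD1 hδ hF
  obtain ⟨w, hw, -⟩ := exists_integer_eq_half_one_add_sqrt hδ hn
  subst hε
  have hDR : (D : ℝ) = s ^ 2 + 4 := by exact_mod_cast congrArg (Int.cast (R := ℝ)) hDs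
  have habs : |(s : ℝ)| < √D := by
    rw [← Real.sqrt_sq_eq_abs]
    exact Real.sqrt_lt_sqrt (sq_nonneg _) (by rw [hDR]; linarith)
  obtain ⟨hlt₁, hlt₂⟩ := abs_lt.mp habs
  have hpos : IsTotallyPositive α := by
    intro σ
    rw [hα]
    rcases hσ σ with rfl | rfl
    · simp only [map_add, map_div₀, map_intCast, map_ofNat, h₁]
      exact div_pos (by linarith) (by linarith)
    · simp only [map_add, map_div₀, map_intCast, map_ofNat, h₂]
      exact div_pos_of_neg_of_neg (by linarith) (by linarith)
  have hint : ∀ x : 𝓞 F, ∃ m n : ℤ, (x : F) = m + n * ((δ - s) / 2) := fun x =>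
    exists_int_add_int_mul_of_isIntegral hDsq hD1 hδ hF hsodd hDmod x.isIntegral_coe
  have hsim := isSimilarLattice_twistedLattice_standardOrder hs.symm hDs hD8 hδ hw hint hpos hα
    h₁ h₂ hne hσ
  refine ⟨isMaximalQuaternionOrder_standardOrder hδ hn, hpos, hsim, fun ω => ?_⟩
  refine isGeneratorMatrix_twistedMatrix ω (orderBasis D δ) α ?_ (hsim.span_eq_top span_latticeE8)
  classical
  rw [← Finset.card_univ, ← Finset.card_pair hne]
  congr 1
  ext σ
  simpa using hσ σ
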